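/- Let $m\ge 1$ and let $C=[C_{i,j}]$ be a symmetric $m\times m$ matrix of non-negative integers (the matrix of a symmetric quiver with $m$ vertices). Put $(q^2;q^2)_d=\prod_{k=1}^{d}(1-q^{2k})$ and consider the formal power series $$P_C(x_1,\ldots,x_m)=\sum_{d_1,\ldots,d_m\ge 0}\frac{(-q)^{\sum_{i,j=1}^m C_{i,j}d_id_j}}{(q^2;q^2)_{d_1}\cdots(q^2;q^2)_{d_m}}\,x_1^{d_1}\cdots x_m^{d_m}.$$ A set of $k\geq 1$ pairs $(i_u,j_u)$ with $1\le i_u,j_u\le m$ is called admissible if its second entries $j_1,\ldots,j_k$ are pairwise distinct and it contains no cycle, i.e. for no $n\ge1$ does it contain $n$ distinct pairs such that the second entry of each is the first entry of the next one, cyclically (in particular it contains no pair $(i,i)$). Let $$A_C(x_1,\ldots,x_m)=1+\sum_{k=1}^{m-1}\ \sum_{\substack{\Sigma\ \text{admissible}\\ |\Sigma|=k}}\ \prod_{(i,j)\in\Sigma}C_{i,j}\,x_i .$$ (1) The limit $$y(x_1,\ldots,x_m)=\lim_{q\to1}\frac{P_C(q^2x_1,\ldots,q^2x_m)}{P_C(x_1,\ldots,x_m)}=\sum_{l_1,\ldots,l_m\ge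 0}b_{l_1,\ldots,l_m}x_1^{l_1}\cdots x_m^{l_m}$$ exists coefficientwise, and for all $l_1,\ldots,l_m\ge 0$ $$b_{l_1,\ldots,l_m}=(-1)^{\sum_{i=1}^m(C_{i,i}+1)l_i}\,A_C(l_1,\ldots,l_m)\prod_{j=1}^m\frac{1}{1+\sum_{i=1}^mC_{i,j}l_i}\binom{1+\sum_{i=1}^mC_{i,j}l_i}{l_j}.$$ (2) $A_C$ is a polynomial of total degree at most $m-1$, with equality if the quiver is connected (i.e. the graph joining $i\ne j$ when $C_{i,j}\neq0$ is connected), and its coefficients depend only on the off-diagonal entries of $C$. (3) The family $P_m(C)=A_C$, where $m\ge1$ and $C$ runs over the symmetric $m\times m$ matrices of non-negative integers, satisfies - (A0) $P_1(C)(x)=1$; - (A1) $P_m(\sigma\circ C)(x_{\sigma_1},\ldots,x_{\sigma_m})=P_m(C)(x_1,\ldots,x_m)$ for all permutations $\sigma\in S_m$, where $[\sigma\circ C]_{i,j}=C_{\sigma_i,\sigma_j}$; - (A2) for $m\geq 2$, $P_m(C)(x_1,\ldots,x_{m-1},0)=P_{m-1}(C')(x_1,\ldots,x_{m-1})\bigl(1+\sum_{i=1}^{m-1}C_{i,m}x_i\bigr)$,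 where $C'$ is formed by the first $m-1$ rows and columns of $C$; and it is the only family of polynomials $P_m(C)\in\mathbb{Q}[x_1,\ldots,x_m]$ of total degree at most $m-1$ that satisfies (A0), (A1) and (A2). -/

import Mathlib

open Filter Topology

noncomputable section

namespace SymmetricQuiver

/-- The `q`-Pochhammer symbol `(a; q)_n = ∏_{k=0}^{n-1} (1 - a q^k)`. -/
def qPochhammer (a q : ℝ) (n : ℕ) : ℝ :=
  ∏ k ∈ Finset.range n, (1 - a * q ^ k)

/-- The motivic generating series of the quiver with matrix `C`, as a formal power series in
`x_1, …, x_m`: the coefficient of `x^d` is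
`(-q)^{∑ C_{ij} d_i d_j} / ((q²;q²)_{d_1} ⋯ (q²;q²)_{d_m})`. -/
def motivicSeries {m : ℕ} (C : Matrix (Fin m) (Fin m) ℕ) (q : ℝ) : MvPowerSeries (Fin m) ℝ :=
  fun d => (-q) ^ (∑ i, ∑ j, C i j * d i * d j) / ∏ i, qPochhammer (q ^ 2) (q ^ 2) (d i)

/-- The formal power series `P_C(q² x_1, …, q² x_m) / P_C(x_1, …, x_m)`. -/
def seriesRatio {m : ℕ} (C : Matrix (Fin m) (Fin m) ℕ) (q : ℝ) : MvPowerSeries (Fin m) ℝ :=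
  MvPowerSeries.rescale (fun _ => q ^ 2) (motivicSeries C q) * (motivicSeries C q)⁻¹

/-- A finite set of pairs contains a cycle if, for some length `n + 1 ≥ 1`, it contains distinct
pairs `p_0, …, p_n` such that the second entry of each is the first entry of the next one,
cyclically (addition in `Fin (n + 1)` wraps around). -/
def HasCycle {m : ℕ} (S : Finset (Fin m × Fin m)) : Prop :=
  ∃ (n : ℕ) (p : Fin (n + 1) → Fin m × Fin m),
    Function.Injective p ∧ (∀ t, p t ∈ S) ∧ ∀ t, (p t).2 = (p (t + 1)).1

/-- A set of pairs is admissible if the second entries are distinct and it contains no cycle. -/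
def Admissible {m : ℕ} (S : Finset (Fin m × Fin m)) : Prop :=
  (∀ p ∈ S, ∀ p' ∈ S, p.2 = p'.2 → p = p') ∧ ¬ HasCycle S

open Classical in
/-- The admissible sets consisting of exactly `k` pairs. -/
def admissibleSets (m k : ℕ) : Finset (Finset (Fin m × Fin m)) :=
  (Finset.powersetCard k Finset.univ).filter Admissible

/-- The polynomial `A = 1 + ∑_{k=1}^{m-1} ∑_{Σ admissible, |Σ| = k} ∏_{(i,j) ∈ Σ} C_{ij} x_i`. -/
def forestPolynomial {m : ℕ} (C : Matrix (Fin m) (Fin m) ℕ) : MvPolynomial (Fin m) ℚ :=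
  1 + ∑ k ∈ Finset.Icc 1 (m - 1), ∑ S ∈ admissibleSets m k,
    ∏ p ∈ S, MvPolynomial.C (C p.1 p.2 : ℚ) * MvPolynomial.X p.1

/-- The conditions (A0), (A1), (A2) on a family of polynomials `P_m(C)(x_1, …, x_m)`, where `m ≥ 1`
and `C` is a symmetric `m × m` matrix of non-negative integers. The value at `m = 0` is
irrelevant. -/
structure SatisfiesAxioms
    (P : ∀ m : ℕ, Matrix (Fin m) (Fin m) ℕ → MvPolynomial (Fin m) ℚ) : Prop where
  /-- `P_1(C)(x) = 1`. -/
  A0 : ∀ C : Matrix (Fin 1) (Fin 1) ℕ, P 1 C = 1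
  /-- `P_m(σ ∘ C)(x_{σ 1}, …, x_{σ m}) = P_m(C)(x_1, …, x_m)`, where
  `(σ ∘ C)_{ij} = C_{σ i, σ j}`. -/
  A1 : ∀ m : ℕ, 1 ≤ m → ∀ C : Matrix (Fin m) (Fin m) ℕ, C.IsSymm → ∀ σ : Equiv.Perm (Fin m),
    MvPolynomial.rename σ (P m (C.submatrix σ σ)) = P m C
  /-- `P_{m+1}(C)(x_1, …, x_m, 0) = P_m(C')(x_1, …, x_m) (1 + ∑_{i ≤ m} C_{i,m+1} x_i)`, where `C'`
  is formed by the first `m` rows and columns of `C`. -/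
  A2 : ∀ m : ℕ, 1 ≤ m → ∀ C : Matrix (Fin (m + 1)) (Fin (m + 1)) ℕ, C.IsSymm →
    MvPolynomial.aeval
        (Fin.snoc (α := fun _ => MvPolynomial (Fin m) ℚ) MvPolynomial.X 0) (P (m + 1) C) =
      P m (C.submatrix Fin.castSucc Fin.castSucc) *
        (1 + ∑ i : Fin m,
          MvPolynomial.C (C i.castSucc (Fin.last m) : ℚ) * MvPolynomial.X i)

/-- The simple graph on the vertices of the quiver: distinct vertices are joined when there is at
least one arrow between them. -/
def underlyingGraph {m : ℕ} (C : Matrix (Fin m) (Fin m) ℕ) : SimpleGraph (Fin m) :=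
  SimpleGraph.fromRel (fun i j => C i j ≠ 0)

end SymmetricQuiver

end

/-! The ratio for the shift `1` is embedded in the family `R_a = P_C(q^(2a) x) / P_C(x)` with `a` in
`ℕ^m`. Cancelling one Pochhammer factor gives the q-difference equation `R_(a+e_i) = R_a -
(-q)^(C_ii) q^(2a_i) x_i R_(a+C_i)`, where `C_i` is the `i`-th row (`shiftedSeries_add_single`).
With `R_0 = 1` it determines every coefficient recursively, so the limits exist as soon as some
array solves the recursion at `q = 1`. Up to sign, `det (limitMatrix C a l)` does: the recursion is
Pascal's rule in a single column (`det_limitMatrix_add_single`), and for `a = 0`, `l ≠ 0` the row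
vector `l` is in the kernel.

At `a = 1` the binomials factor out of the columns, leaving the value at `l` of a determinant of
linear forms. That this determinant is the forest polynomial is a matrix-tree theorem, obtained from
uniqueness: both families satisfy (A0)-(A2) and the degree bound. Uniqueness holds because the
difference of two such families vanishes at `x_m = 0`, hence by symmetry at each `x_i = 0`; each of
its monomials would then involve all `m` variables, contradicting degree at most `m - 1`. -/

namespace SymmetricQuiver

/-! ### Determinants solving the recursion at `q = 1` -/

/-- The coefficient of `u ^ k` in `u * (1 + u) ^ (n - 1)`, where `n - 1 = -1` for `n = 0`. -/
def predChoose : ℕ → ℕ → ℤ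
  | _, 0 => 0
  | 0, k + 1 => (-1) ^ k
  | n + 1, k + 1 => n.choose k

@[simp] theorem predChoose_zero_right (n : ℕ) : predChoose n 0 = 0 := by
  cases n <;> rfl

theorem predChoose_succ_succ (n k : ℕ) :
    predChoose (n + 1) (k + 1) = predChoose n (k + 1) + predChoose n k := by
  rcases n with _ | n <;> rcases k with _ | k <;>
    simp [predChoose, pow_succ, Nat.choose_succ_succ]
  ring

/-- Absorption identity; it makes `l` a kernel vector for `a = 0` and lets the binomials factor out
for `a = 1`. -/
theorem natCast_mul_choose_eq (n k : ℕ) :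
    (k : ℤ) * (n.choose k : ℤ) = n * predChoose n k := by
  rcases n with _ | n <;> rcases k with _ | k <;> simp [predChoose]
  have := Nat.add_one_mul_choose_eq n k
  zify at this
  linarith

variable {m : ℕ}

/-- The numbers `a_j + ∑ i, C_{ij} l_i`. -/
def shiftedCount (C : Matrix (Fin m) (Fin m) ℕ) (a l : Fin m → ℕ) (j : Fin m) : ℕ :=
  a j + ∑ i, C i j * l i

theorem shiftedCount_add_left (C : Matrix (Fin m) (Fin m) ℕ) (a b l : Fin m → ℕ) (j : Fin m) :
    shiftedCount C (a + b) l j = shiftedCount C a l j + b j := by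
  simp only [shiftedCount, Pi.add_apply]
  ring

theorem shiftedCount_add_single_right (C : Matrix (Fin m) (Fin m) ℕ) (a l : Fin m → ℕ)
    (i j : Fin m) :
    shiftedCount C a (l + Pi.single i 1) j = shiftedCount C a l j + C i j := by
  simp only [shiftedCount, Pi.add_apply, mul_add, Finset.sum_add_distrib, Pi.single_apply, mul_ite,
    mul_one, mul_zero, Finset.sum_ite_eq', Finset.mem_univ, if_true, add_assoc]

/-- The matrix whose determinant is, up to sign, the coefficient of `x ^ l` in the classical limit
of `P_C(q ^ (2 a) x) / P_C(x)`. -/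
def limitMatrix (C : Matrix (Fin m) (Fin m) ℕ) (a l : Fin m → ℕ) : Matrix (Fin m) (Fin m) ℤ :=
  Matrix.of fun i j => (if i = j then ((shiftedCount C a l j).choose (l j) : ℤ) else 0)
    - C i j * predChoose (shiftedCount C a l j) (l j)

theorem det_limitMatrix_zero_right (C : Matrix (Fin m) (Fin m) ℕ) (a : Fin m → ℕ) :
    (limitMatrix C a 0).det = 1 := by
  have : limitMatrix C a 0 = 1 := by
    ext i j
    simp [limitMatrix, Matrix.one_apply]
  simp [this]

/-- The nonzero row vector `l` annihilates the matrix from the left, by absorption in each column.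
-/
theorem det_limitMatrix_zero_left (C : Matrix (Fin m) (Fin m) ℕ) {l : Fin m → ℕ} (hl : l ≠ 0) :
    (limitMatrix C 0 l).det = 0 := by
  apply Matrix.exists_vecMul_eq_zero_iff.1
  refine ⟨fun i => (l i : ℤ), fun h => hl (funext fun i => by simpa using congrFun h i), ?_⟩
  funext j
  have h := natCast_mul_choose_eq (∑ i, C i j * l i) (l j)
  push_cast at h
  simp only [Matrix.vecMul, dotProduct, limitMatrix, Matrix.of_apply, mul_sub, mul_ite, mul_zero,
    Finset.sum_sub_distrib, Finset.sum_ite_eq', Finset.mem_univ, if_true, Pi.zero_apply, zero_add,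
    shiftedCount]
  rw [h, sub_eq_zero, Finset.sum_mul]
  exact Finset.sum_congr rfl fun i _ => by ring

/-- When `l i = 0`, column `i` is a standard basis vector whatever `a i` is, and no other column
sees `a i`. -/
theorem det_limitMatrix_add_single_of_eq_zero (C : Matrix (Fin m) (Fin m) ℕ) (a l : Fin m → ℕ)
    (i : Fin m) (hi : l i = 0) :
    (limitMatrix C (a + Pi.single i 1) l).det = (limitMatrix C a l).det := by
  congr 1
  ext r j
  rcases eq_or_ne j i with rfl | hj
  · simp [limitMatrix, hi]
  · simp [limitMatrix, shiftedCount_add_left, hj]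

/-- The three matrices agree outside column `i`, since column `j` depends on `a` and `l` only
through `shiftedCount C a l j` and `l j`. In column `i` Pascal's rule holds entrywise, and the
determinant is additive in that column. -/
theorem det_limitMatrix_add_single (C : Matrix (Fin m) (Fin m) ℕ) (a l : Fin m → ℕ)
    (i : Fin m) :
    (limitMatrix C (a + Pi.single i 1) (l + Pi.single i 1)).det =
      (limitMatrix C a (l + Pi.single i 1)).det + (limitMatrix C (a + C i) l).det := by
  have h1 : limitMatrix C (a + Pi.single i 1) (l + Pi.single i 1) =
      (limitMatrix C (a + C i) l).updateCol i
        ((fun r => limitMatrix C a (l + Pi.single i 1) r i) +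
          fun r => limitMatrix C (a + C i) l r i) := by
    ext r j
    rcases eq_or_ne j i with rfl | hj
    · simp only [limitMatrix, Matrix.of_apply, shiftedCount_add_left,
        shiftedCount_add_single_right, Matrix.updateCol_self, Pi.add_apply,
        Pi.single_eq_same]
      rw [add_right_comm _ 1 (C j j), predChoose_succ_succ, Nat.choose_succ_succ']
      split_ifs <;> push_cast <;> ring
    · simp only [limitMatrix, Matrix.of_apply, shiftedCount_add_left,
        shiftedCount_add_single_right, Matrix.updateCol_ne hj, Pi.add_apply,
        Pi.single_eq_of_ne hj, add_zero]
  have h2 : (limitMatrix C (a + C i) l).updateCol i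
      (fun r => limitMatrix C a (l + Pi.single i 1) r i) = limitMatrix C a (l + Pi.single i 1) := by
    ext r j
    rcases eq_or_ne j i with rfl | hj
    · simp
    · simp only [limitMatrix, Matrix.of_apply, shiftedCount_add_left,
        shiftedCount_add_single_right, Matrix.updateCol_ne hj, Pi.add_apply, Pi.single_eq_of_ne hj, add_zero]
  rw [h1, Matrix.det_updateCol_add, h2, Matrix.updateCol_eq_self]

theorem det_limitMatrix_one (C : Matrix (Fin m) (Fin m) ℕ) (l : Fin m → ℕ) :
    ((limitMatrix C 1 l).det : ℚ) =
      (∏ j, (1 / (1 + ∑ i, (C i j : ℚ) * (l i : ℚ))) * ((1 + ∑ i, C i j * l i).choose (l j) : ℚ)) *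
        (Matrix.of fun i j => (if i = j then 1 + ∑ k, (C k j : ℚ) * (l k : ℚ) else 0)
          - (C i j : ℚ) * (l j : ℚ)).det := by
  rw [← Matrix.det_mul_row, ← eq_intCast (Int.castRingHom ℚ), RingHom.map_det]
  congr 1
  ext i j
  have h := congrArg (Int.cast : ℤ → ℚ) (natCast_mul_choose_eq (1 + ∑ i, C i j * l i) (l j))
  push_cast at h
  have hpos : (1 + ∑ i, (C i j : ℚ) * (l i : ℚ)) ≠ 0 := by positivity
  simp only [limitMatrix, RingHom.mapMatrix_apply, Matrix.map_apply, Matrix.of_apply,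
    Pi.one_apply, shiftedCount, Int.coe_castRingHom]
  have h' : (predChoose (1 + ∑ i, C i j * l i) (l j) : ℚ) =
      (1 / (1 + ∑ i, (C i j : ℚ) * (l i : ℚ))) * (l j * (1 + ∑ i, C i j * l i).choose (l j)) := by
    rw [h]; field_simp
  split_ifs
  · push_cast
    rw [h']
    field_simp
  · push_cast
    rw [h']
    ring

/-! ### The q-difference equation -/

theorem qPochhammer_succ (a q : ℝ) (n : ℕ) :
    qPochhammer a q (n + 1) = qPochhammer a q n * (1 - a * q ^ n) :=
  Finset.prod_range_succ _ _

theorem prod_qPochhammer_add_single (d : Fin m →₀ ℕ) (q : ℝ) (i : Fin m) :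
    ∏ j, qPochhammer (q ^ 2) (q ^ 2) ((d + Finsupp.single i 1 : Fin m →₀ ℕ) j) =
      (1 - q ^ (2 * (d i + 1))) * ∏ j, qPochhammer (q ^ 2) (q ^ 2) (d j) := by
  rw [← Finset.mul_prod_erase _ _ (Finset.mem_univ i),
    ← Finset.mul_prod_erase _ (fun j => qPochhammer (q ^ 2) (q ^ 2) (d j)) (Finset.mem_univ i),
    Finset.prod_congr rfl (g := fun j => qPochhammer (q ^ 2) (q ^ 2) (d j))]
  · simp only [Finsupp.add_apply, Finsupp.single_eq_same, qPochhammer_succ]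
    ring
  · intro j hj
    simp [Finsupp.single_eq_of_ne (Finset.ne_of_mem_erase hj)]

theorem quadraticForm_add_single (C : Matrix (Fin m) (Fin m) ℕ) (hC : C.IsSymm)
    (d : Fin m →₀ ℕ) (i : Fin m) :
    ∑ r, ∑ j, C r j * (d + Finsupp.single i 1 : Fin m →₀ ℕ) r *
        (d + Finsupp.single i 1 : Fin m →₀ ℕ) j =
      ∑ r, ∑ j, C r j * d r * d j + C i i + 2 * ∑ j, C i j * d j := by
  have h (r : Fin m) : C r i = C i r := hC.apply i r
  simp only [Finsupp.add_apply, Finsupp.single_apply, mul_add, add_mul, Finset.sum_add_distrib,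
    mul_ite, ite_mul, mul_one, mul_zero, zero_mul, Finset.sum_ite_eq, Finset.mem_univ, if_true,
    Finset.sum_ite_irrel, Finset.sum_const_zero, h]
  ring

/-- The series `P_C(q ^ (2 a_1) x_1, …, q ^ (2 a_m) x_m)`. -/
noncomputable def shiftedSeries (C : Matrix (Fin m) (Fin m) ℕ) (q : ℝ) (a : Fin m → ℕ) :
    MvPowerSeries (Fin m) ℝ :=
  MvPowerSeries.rescale (fun i => q ^ (2 * a i)) (motivicSeries C q)

theorem coeff_shiftedSeries (C : Matrix (Fin m) (Fin m) ℕ) (q : ℝ) (a : Fin m → ℕ)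
    (d : Fin m →₀ ℕ) :
    MvPowerSeries.coeff d (shiftedSeries C q a) =
      q ^ (2 * ∑ i, a i * d i) * ((-q) ^ (∑ i, ∑ j, C i j * d i * d j) /
        ∏ i, qPochhammer (q ^ 2) (q ^ 2) (d i)) := by
  rw [shiftedSeries, MvPowerSeries.coeff_rescale]
  congr 1
  rw [Finsupp.prod_fintype _ _ (by simp), Finset.mul_sum, ← Finset.prod_pow_eq_pow_sum]
  exact Finset.prod_congr rfl fun i _ => by rw [← pow_mul, mul_assoc]

/-- The factor `1 - q^(2 d_i)` cancels the last factor of `(q²;q²)_(d_i)`. Lowering `d_i` by one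
then changes the quadratic form by `C i i` plus an even linear form in the remaining exponents, and
the latter is absorbed by the shift `a + C i`. -/
theorem shiftedSeries_add_single (C : Matrix (Fin m) (Fin m) ℕ) (hC : C.IsSymm) {q : ℝ}
    (hq : ∀ n : ℕ, q ^ (2 * (n + 1)) ≠ 1) (a : Fin m → ℕ) (i : Fin m) :
    shiftedSeries C q (a + Pi.single i 1) = shiftedSeries C q a -
      MvPowerSeries.monomial (Finsupp.single i 1) ((-q) ^ C i i * q ^ (2 * a i)) *
        shiftedSeries C q (a + C i) := by
  ext d
  rw [map_sub, MvPowerSeries.coeff_monomial_mul]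
  have hlin : ∑ j, (a + Pi.single i 1 : Fin m → ℕ) j * d j = ∑ j, a j * d j + d i := by
    simp [add_mul, Finset.sum_add_distrib, Pi.single_apply]
  split_ifs with h
  · obtain ⟨e, rfl⟩ := exists_add_of_le h
    rw [add_comm _ e] at *
    have h1 : (1 : ℝ) - q ^ (2 * (e i + 1)) ≠ 0 := sub_ne_zero.2 (hq (e i)).symm
    have h2 : ∑ j, (a + C i) j * e j = ∑ j, a j * e j + ∑ j, C i j * e j := by
      simp [add_mul, Finset.sum_add_distrib]
    have h3 : ∑ j, a j * (e + Finsupp.single i 1 : Fin m →₀ ℕ) j = ∑ j, a j * e j + a i := by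
      simp [mul_add, Finset.sum_add_distrib, Finsupp.single_apply]
    rw [add_tsub_cancel_right]
    simp only [coeff_shiftedSeries, prod_qPochhammer_add_single, quadraticForm_add_single C hC,
      hlin, h2, h3]
    have h4 : (e + Finsupp.single i 1 : Fin m →₀ ℕ) i = e i + 1 := by simp
    rw [h4]
    simp only [div_eq_mul_inv, mul_inv]
    rw [pow_add (-q), pow_add (-q), pow_mul (-q) 2, neg_sq]
    field_simp
    ring
  · have h0 : d i = 0 := by simpa using h
    simp only [coeff_shiftedSeries, hlin, h0, add_zero, sub_zero]

theorem constantCoeff_motivicSeries (C : Matrix (Fin m) (Fin m) ℕ) (q : ℝ) :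
    MvPowerSeries.constantCoeff (motivicSeries C q) = 1 := by
  rw [← MvPowerSeries.coeff_zero_eq_constantCoeff_apply, MvPowerSeries.coeff_apply]
  simp [motivicSeries, qPochhammer]

/-- The series `P_C(q ^ (2 a) x) / P_C(x)`. -/
noncomputable def shiftedRatio (C : Matrix (Fin m) (Fin m) ℕ) (q : ℝ) (a : Fin m → ℕ) :
    MvPowerSeries (Fin m) ℝ :=
  shiftedSeries C q a * (motivicSeries C q)⁻¹

theorem shiftedRatio_one (C : Matrix (Fin m) (Fin m) ℕ) (q : ℝ) :
    shiftedRatio C q 1 = seriesRatio C q := by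
  simp [shiftedRatio, seriesRatio, shiftedSeries]

theorem shiftedRatio_zero (C : Matrix (Fin m) (Fin m) ℕ) (q : ℝ) :
    shiftedRatio C q 0 = 1 := by
  have : (fun i : Fin m => q ^ (2 * (0 : Fin m → ℕ) i)) = 1 := by ext; simp
  rw [shiftedRatio, shiftedSeries, this, MvPowerSeries.rescale_one, RingHom.id_apply,
    MvPowerSeries.mul_inv_cancel _ (by simp [constantCoeff_motivicSeries])]

theorem coeff_shiftedRatio_add_single (C : Matrix (Fin m) (Fin m) ℕ) (hC : C.IsSymm) {q : ℝ}
    (hq : ∀ n : ℕ, q ^ (2 * (n + 1)) ≠ 1) (a : Fin m → ℕ) (i : Fin m) (l : Fin m →₀ ℕ) :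
    MvPowerSeries.coeff l (shiftedRatio C q (a + Pi.single i 1)) =
      MvPowerSeries.coeff l (shiftedRatio C q a) -
        if Finsupp.single i 1 ≤ l then (-q) ^ C i i * q ^ (2 * a i) *
          MvPowerSeries.coeff (l - Finsupp.single i 1) (shiftedRatio C q (a + C i)) else 0 := by
  rw [shiftedRatio, shiftedSeries_add_single C hC hq, sub_mul, mul_assoc, map_sub,
    MvPowerSeries.coeff_monomial_mul]
  rfl

/-! ### The limit `q → 1` -/

theorem eventually_pow_ne_one :
    ∀ᶠ q : ℝ in 𝓝[≠] 1, ∀ n : ℕ, q ^ (2 * (n + 1)) ≠ 1 := by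
  have h : ∀ᶠ q : ℝ in 𝓝[≠] 1, 0 < q := nhdsWithin_le_nhds (lt_mem_nhds one_pos)
  filter_upwards [h, self_mem_nhdsWithin] with q hq hq1 n hn
  exact hq1 ((pow_eq_one_iff_of_nonneg hq.le (by positivity)).1 hn)

/-- The limit of the coefficients of `P_C(q ^ (2 a) x) / P_C(x)` as `q → 1`. -/
def limitCoeff (C : Matrix (Fin m) (Fin m) ℕ) (a l : Fin m → ℕ) : ℤ :=
  (-1) ^ (∑ i, (C i i + 1) * l i) * (limitMatrix C a l).det

/-- Double induction, on the degree of `l` and then on `∑ a_i`: the term with shift `a + C i` may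
have a larger shift, but its degree in `x` is smaller. -/
theorem tendsto_coeff_shiftedRatio (C : Matrix (Fin m) (Fin m) ℕ) (hC : C.IsSymm)
    (a : Fin m → ℕ) (l : Fin m →₀ ℕ) :
    Tendsto (fun q : ℝ => MvPowerSeries.coeff l (shiftedRatio C q a)) (𝓝[≠] 1)
      (𝓝 (limitCoeff C a l : ℝ)) := by
  induction hn : l.degree using Nat.strong_induction_on generalizing l a with
  | _ n ih =>
  subst hn
  induction hk : ∑ i, a i generalizing a with
  | zero =>
    obtain rfl : a = 0 := by ext i; simpa using (Finset.sum_eq_zero_iff.1 hk) i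
    simp only [shiftedRatio_zero, MvPowerSeries.coeff_one]
    rcases eq_or_ne l 0 with rfl | hl
    · simp [limitCoeff, det_limitMatrix_zero_right]
    · have : (l : Fin m → ℕ) ≠ 0 := fun h => hl (DFunLike.coe_injective h)
      simp [limitCoeff, det_limitMatrix_zero_left C this, hl]
  | succ k ihk =>
    obtain ⟨i, -, hi⟩ := Finset.exists_ne_zero_of_sum_ne_zero (hk.trans_ne k.succ_ne_zero)
    obtain ⟨b, rfl⟩ : ∃ b : Fin m → ℕ, a = b + Pi.single i 1 := by
      refine ⟨a - Pi.single i 1, (tsub_add_cancel_of_le fun j => ?_).symm⟩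
      rcases eq_or_ne j i with rfl | hj
      · simpa using Nat.one_le_iff_ne_zero.2 hi
      · simp [hj]
    have hb : ∑ j, b j = k := by
      simpa [Finset.sum_add_distrib, Pi.single_apply] using hk
    have hq : Tendsto (fun q : ℝ => (-q) ^ C i i * q ^ (2 * b i)) (𝓝[≠] 1)
        (𝓝 ((-1) ^ C i i)) := by
      have : Continuous fun q : ℝ => (-q) ^ C i i * q ^ (2 * b i) := by fun_prop
      simpa using (this.tendsto 1).mono_left nhdsWithin_le_nhds
    refine Tendsto.congr' (eventually_pow_ne_one.mono fun q hq =>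
      (coeff_shiftedRatio_add_single C hC hq b i l).symm) ?_
    split_ifs with hil
    · obtain ⟨e, rfl⟩ := exists_add_of_le hil
      rw [add_comm _ e, add_tsub_cancel_right] at *
      have he := ih _ (by simp [Finsupp.degree_single]) (b + C i) e rfl
      convert (ihk b hb).sub (hq.mul he) using 2
      have hl : ((e + Finsupp.single i 1 : Fin m →₀ ℕ) : Fin m → ℕ) = ⇑e + Pi.single i 1 := by
        ext j; simp [Finsupp.single_apply, Pi.single_apply, eq_comm]
      have hs : ∑ j, (C j j + 1) * (⇑e + Pi.single i 1 : Fin m → ℕ) j =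
          ∑ j, (C j j + 1) * e j + (C i i + 1) := by
        simp only [Pi.add_apply, mul_add _ (e _), Finset.sum_add_distrib]
        simp [Pi.single_apply]
      simp only [limitCoeff, hl, det_limitMatrix_add_single, hs]
      simp only [Int.cast_mul, Int.cast_add, Int.cast_pow, Int.cast_neg, Int.cast_one, pow_add,
        pow_one]
      ring
    · have h0 : l i = 0 := by simpa using hil
      simpa only [sub_zero, limitCoeff, det_limitMatrix_add_single_of_eq_zero C b l i h0]
        using ihk b hb

/-! ### Uniqueness from the axioms -/

theorem aeval_snoc_monomial (d : Fin (m + 1) →₀ ℕ) (c : ℚ) :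
    MvPolynomial.aeval (Fin.snoc (α := fun _ => MvPolynomial (Fin m) ℚ) MvPolynomial.X 0)
        (MvPolynomial.monomial d c) =
      if d (Fin.last m) = 0 then
        MvPolynomial.monomial (d.comapDomain Fin.castSucc (Fin.castSucc_injective m).injOn) c
      else 0 := by
  rw [MvPolynomial.aeval_monomial, Finsupp.prod_fintype _ _ (by simp), Fin.prod_univ_castSucc,
    MvPolynomial.monomial_eq (s := Finsupp.comapDomain _ _ _), Finsupp.prod_fintype _ _ (by simp)]
  split_ifs with h <;> simp [h, MvPolynomial.algebraMap_eq]

theorem coeff_aeval_snoc (p : MvPolynomial (Fin (m + 1)) ℚ) (d : Fin (m + 1) →₀ ℕ)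
    (hd : d (Fin.last m) = 0) :
    MvPolynomial.coeff (d.comapDomain Fin.castSucc (Fin.castSucc_injective m).injOn)
        (MvPolynomial.aeval
          (Fin.snoc (α := fun _ => MvPolynomial (Fin m) ℚ) MvPolynomial.X 0) p) =
      MvPolynomial.coeff d p := by
  induction p using MvPolynomial.induction_on' with
  | add p q hp hq => rw [map_add, MvPolynomial.coeff_add, MvPolynomial.coeff_add, hp, hq]
  | monomial e c =>
    rw [aeval_snoc_monomial, MvPolynomial.coeff_monomial]
    split_ifs with h1 h2 h2
    · simp [h2]
    · rw [MvPolynomial.coeff_monomial, if_neg]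
      contrapose! h2
      ext i
      refine Fin.lastCases (by rw [h1, hd]) (fun j => ?_) i
      simpa using DFunLike.congr_fun h2 j
    · exact absurd (h2 ▸ hd) h1
    · simp

/-- A family satisfying the axioms is determined by them and the degree bound. -/
theorem SatisfiesAxioms.unique
    {P Q : ∀ m : ℕ, Matrix (Fin m) (Fin m) ℕ → MvPolynomial (Fin m) ℚ}
    (hP : SatisfiesAxioms P) (hQ : SatisfiesAxioms Q)
    (hP' : ∀ (m : ℕ) (C : Matrix (Fin m) (Fin m) ℕ), 1 ≤ m → C.IsSymm →
      (P m C).totalDegree ≤ m - 1)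
    (hQ' : ∀ (m : ℕ) (C : Matrix (Fin m) (Fin m) ℕ), 1 ≤ m → C.IsSymm →
      (Q m C).totalDegree ≤ m - 1)
    (m : ℕ) (C : Matrix (Fin m) (Fin m) ℕ) (hm : 1 ≤ m) (hC : C.IsSymm) : P m C = Q m C := by
  induction m, hm using Nat.le_induction with
  | base => rw [hP.A0, hQ.A0]
  | succ m hm ih =>
  have hlast (D : Matrix (Fin (m + 1)) (Fin (m + 1)) ℕ) (hD : D.IsSymm) (d : Fin (m + 1) →₀ ℕ)
      (hd : MvPolynomial.coeff d (P (m + 1) D - Q (m + 1) D) ≠ 0) : d (Fin.last m) ≠ 0 := by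
    intro h0
    rw [← coeff_aeval_snoc _ _ h0, map_sub, hP.A2 m hm D hD, hQ.A2 m hm D hD,
      ih _ (hD.submatrix _), sub_self] at hd
    simp at hd
  rw [← sub_eq_zero, MvPolynomial.eq_zero_iff]
  intro d
  by_contra hd
  have hne (i : Fin (m + 1)) : 1 ≤ d i := by
    -- (A1) for this transposition carries the statement about the last variable to `x_i`.
    set σ := Equiv.swap (Fin.last m) i
    rw [← hP.A1 _ (by omega) C hC σ, ← hQ.A1 _ (by omega) C hC σ, ← map_sub] at hd
    obtain ⟨e, rfl, he⟩ := MvPolynomial.coeff_rename_ne_zero _ _ _ hd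
    have := hlast _ (hC.submatrix _) e he
    rw [← Finsupp.mapDomain_apply σ.injective e (Fin.last m)] at this
    simp only [σ, Equiv.swap_apply_left] at this
    exact Nat.one_le_iff_ne_zero.2 this
  have h1 : (P (m + 1) C - Q (m + 1) C).totalDegree ≤ m :=
    (MvPolynomial.totalDegree_sub _ _).trans
      (max_le (hP' _ C (by omega) hC) (hQ' _ C (by omega) hC))
  have h2 := (MvPolynomial.le_totalDegree (MvPolynomial.mem_support_iff.2 hd)).trans h1
  rw [Finsupp.sum_fintype _ _ (by simp)] at h2
  have h3 := Finset.sum_le_sum fun i (_ : i ∈ Finset.univ) => hne i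
  simp at h3
  omega

/-! ### The determinant satisfies the axioms -/

/-- The matrix whose determinant is the generating polynomial of rooted forests. -/
noncomputable def forestMatrix (C : Matrix (Fin m) (Fin m) ℕ) :
    Matrix (Fin m) (Fin m) (MvPolynomial (Fin m) ℚ) :=
  Matrix.of fun i j =>
    (if i = j then 1 + ∑ k, MvPolynomial.C (C k j : ℚ) * MvPolynomial.X k else 0)
      - MvPolynomial.C (C i j : ℚ) * MvPolynomial.X i

theorem sum_forestMatrix (C : Matrix (Fin m) (Fin m) ℕ) (j : Fin m) :
    ∑ i, forestMatrix C i j = 1 := by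
  simp [forestMatrix, Finset.sum_sub_distrib]

theorem totalDegree_C_mul_X_le (c : ℚ) (i : Fin m) :
    (MvPolynomial.C c * MvPolynomial.X i : MvPolynomial (Fin m) ℚ).totalDegree ≤ 1 :=
  (MvPolynomial.totalDegree_mul _ _).trans (by simp)

theorem totalDegree_forestMatrix_le (C : Matrix (Fin m) (Fin m) ℕ) (i j : Fin m) :
    (forestMatrix C i j).totalDegree ≤ 1 := by
  refine (MvPolynomial.totalDegree_sub _ _).trans (max_le ?_ (totalDegree_C_mul_X_le _ _))
  split_ifs
  · refine (MvPolynomial.totalDegree_add _ _).trans (max_le (by simp) ?_)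
    exact MvPolynomial.totalDegree_finsetSum_le fun k _ => totalDegree_C_mul_X_le _ _
  · simp

/-- All column sums are `1`, so one row of linear entries can be replaced by ones, which saves one
degree. -/
theorem totalDegree_det_forestMatrix_le (C : Matrix (Fin m) (Fin m) ℕ) (hm : 1 ≤ m) :
    (forestMatrix C).det.totalDegree ≤ m - 1 := by
  obtain ⟨n, rfl⟩ : ∃ n, m = n + 1 := ⟨m - 1, by omega⟩
  have h : (forestMatrix C).det = ((forestMatrix C).updateRow 0 1).det := by
    have := Matrix.det_updateRow_sum (forestMatrix C) 0 1
    rw [Pi.one_apply, one_smul] at this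
    rw [← this]
    congr 2
    ext1 j
    exact (Finset.sum_apply j _ _).trans (by simpa using sum_forestMatrix C j)
  rw [h, Matrix.det_apply]
  refine MvPolynomial.totalDegree_finsetSum_le fun σ _ => ?_
  refine (MvPolynomial.totalDegree_smul_le _ _).trans ?_
  refine (MvPolynomial.totalDegree_finsetProd _ _).trans ?_
  -- Column `σ⁻¹ 0` is where `σ` meets the row of ones, contributing degree `0`.
  rw [← Finset.add_sum_erase _ _ (Finset.mem_univ (σ⁻¹ 0))]
  have h1 : ∀ i ∈ Finset.univ.erase (σ⁻¹ 0),
      ((forestMatrix C).updateRow 0 1 (σ i) i).totalDegree ≤ 1 := by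
    intro i hi
    have : σ i ≠ 0 := fun h => Finset.ne_of_mem_erase hi (by rw [← h]; simp)
    rw [Matrix.updateRow_ne this]
    exact totalDegree_forestMatrix_le C _ _
  have h2 := Finset.sum_le_card_nsmul _ _ _ h1
  simpa using h2

theorem det_forestMatrix_satisfiesAxioms :
    SatisfiesAxioms (fun _ C => (forestMatrix C).det) where
  A0 C := by simp [forestMatrix]
  A1 m _ C _ σ := by
    rw [AlgHom.map_det, ← Matrix.det_submatrix_equiv_self σ (forestMatrix C)]
    congr 1
    ext1 i j
    have : ∑ k, (MvPolynomial.C (C (σ k) (σ j) : ℚ) * MvPolynomial.X (σ k) :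
        MvPolynomial (Fin m) ℚ) = ∑ k, MvPolynomial.C (C k (σ j) : ℚ) * MvPolynomial.X k :=
      Equiv.sum_comp σ fun k => MvPolynomial.C (C k (σ j) : ℚ) * MvPolynomial.X k
    simp only [AlgHom.mapMatrix_apply, Matrix.map_apply, Matrix.submatrix_apply, forestMatrix,
      Matrix.of_apply, map_sub, apply_ite, map_add, map_one, map_sum, map_mul,
      MvPolynomial.rename_C, MvPolynomial.rename_X, map_zero, σ.injective.eq_iff, this]
  A2 m _ C _ := by
    -- At `x_(m+1) = 0` the last row retains only its diagonal entry.
    rw [AlgHom.map_det, Matrix.det_succ_row _ (Fin.last m), Fin.sum_univ_castSucc,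
      Finset.sum_eq_zero, zero_add]
    · rw [mul_comm]
      congr 1
      · congr 1
        ext1 i j
        simp [forestMatrix, Fin.sum_univ_castSucc, apply_ite]
      · simp [forestMatrix, Fin.sum_univ_castSucc, Even.neg_one_pow (Even.add_self m)]
    · intro i _
      simp [forestMatrix, (Fin.castSucc_lt_last i).ne']

/-! ### Admissible sets and the degree of the forest polynomial -/

theorem admissible_empty : Admissible (∅ : Finset (Fin m × Fin m)) :=
  ⟨by simp, fun ⟨_, _, _, h, _⟩ => by simpa using h 0⟩

theorem Admissible.fst_ne_snd {S : Finset (Fin m × Fin m)} (hS : Admissible S)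
    {p : Fin m × Fin m} (hp : p ∈ S) : p.1 ≠ p.2 := fun h =>
  hS.2 ⟨0, fun _ => p, fun s t _ => by omega, fun _ => hp, fun _ => h.symm⟩

/-- A set of pairs containing a pair `(f j, j)` for every vertex `j` contains a cycle. -/
theorem hasCycle_of_forall_mem [NeZero m] {S : Finset (Fin m × Fin m)} (f : Fin m → Fin m)
    (hf : ∀ j, (f j, j) ∈ S) : HasCycle S := by
  obtain ⟨x, hx⟩ : (Function.periodicPts f).Nonempty := by
    obtain ⟨a, b, hab, h⟩ := Finite.exists_ne_map_eq_of_infinite fun n : ℕ => f^[n] 0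
    wlog hlt : a < b generalizing a b
    · exact this b a hab.symm h.symm (by omega)
    refine ⟨f^[a] 0, b - a, by omega, ?_⟩
    rw [Function.IsPeriodicPt, Function.IsFixedPt, ← Function.iterate_add_apply,
      Nat.sub_add_cancel hlt.le]
    exact h.symm
  have hpos := Function.minimalPeriod_pos_of_mem_periodicPts hx
  obtain ⟨n, hn⟩ : ∃ n, Function.minimalPeriod f x = n + 1 := ⟨_, (Nat.succ_pred hpos.ne').symm⟩
  -- The orbit is traversed backwards, since pairs point from `f j` to `j`.
  refine ⟨n, fun t => (f (f^[n - t] x), f^[n - t] x), fun s t h => ?_, fun t => hf _, fun t => ?_⟩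
  · have h' := Function.iterate_injOn_Iio_minimalPeriod (f := f) (x := x)
      (by simp [hn]) (by simp [hn]) (congrArg Prod.snd h)
    omega
  · simp only [← Function.iterate_succ_apply']
    rcases eq_or_ne t (Fin.last n) with rfl | ht
    · have := Function.iterate_minimalPeriod (f := f) (x := x)
      rw [hn] at this
      simp [this]
    · have := Fin.val_add_one_of_lt (Fin.lt_last_iff_ne_last.2 ht)
      rw [this, show n - (t : ℕ) = (n - (t + 1)).succ from by
        have := Fin.lt_last_iff_ne_last.2 ht
        have : (t : ℕ) < n := this
        omega]

/-- With distinct second entries, `m` pairs would make every vertex a second entry and force a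
cycle. -/
theorem Admissible.card_le {S : Finset (Fin m × Fin m)} (hS : Admissible S) :
    S.card ≤ m - 1 := by
  classical
  rcases m with _ | m
  · simp [Finset.eq_empty_of_isEmpty S]
  have h : S.image Prod.snd ≠ Finset.univ := by
    intro h
    have h' (j : Fin (m + 1)) : ∃ i, (i, j) ∈ S := by
      simpa using (h ▸ Finset.mem_univ j : j ∈ S.image Prod.snd)
    choose f hf using h'
    exact hS.2 (hasCycle_of_forall_mem f hf)
  have := Finset.card_lt_card (Finset.ssubset_univ_iff.2 h)
  rw [Finset.card_image_of_injOn fun p hp p' hp' => hS.1 p hp p' hp', Finset.card_fin] at this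
  omega

/-- The contribution of a set of pairs to the forest polynomial. -/
noncomputable def pairsWeight (C : Matrix (Fin m) (Fin m) ℕ) (S : Finset (Fin m × Fin m)) :
    MvPolynomial (Fin m) ℚ :=
  ∏ p ∈ S, MvPolynomial.C (C p.1 p.2 : ℚ) * MvPolynomial.X p.1

open Classical in
theorem forestPolynomial_eq_sum (C : Matrix (Fin m) (Fin m) ℕ) :
    forestPolynomial C = ∑ S with Admissible S, pairsWeight C S := by
  have hmaps : ∀ S ∈ (Finset.univ : Finset (Finset (Fin m × Fin m))).filter Admissible,
      S.card ∈ insert 0 (Finset.Icc 1 (m - 1)) := by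
    intro S hS
    have := (Finset.mem_filter.1 hS).2.card_le
    simp only [Finset.mem_insert, Finset.mem_Icc]
    omega
  rw [← Finset.sum_fiberwise_of_maps_to hmaps, Finset.sum_insert (by simp), forestPolynomial]
  have hfib (k : ℕ) : ((Finset.univ : Finset (Finset (Fin m × Fin m))).filter Admissible).filter
      (fun S => S.card = k) = admissibleSets m k := by
    ext S
    simp [admissibleSets, Finset.mem_powersetCard, and_comm]
  congr 1
  · have : ((Finset.univ : Finset (Finset (Fin m × Fin m))).filter Admissible).filter
        (fun S => S.card = 0) = {∅} := by
      ext S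
      simp only [Finset.mem_filter, Finset.mem_univ, true_and, Finset.card_eq_zero,
        Finset.mem_singleton]
      exact ⟨fun h => h.2, fun h => ⟨h ▸ admissible_empty, h⟩⟩
    rw [this, Finset.sum_singleton, pairsWeight, Finset.prod_empty]
  · exact Finset.sum_congr rfl fun k _ => by rw [hfib]; rfl

theorem pairsWeight_eq_monomial (C : Matrix (Fin m) (Fin m) ℕ) (S : Finset (Fin m × Fin m)) :
    pairsWeight C S =
      MvPolynomial.monomial (∑ p ∈ S, Finsupp.single p.1 1) (∏ p ∈ S, (C p.1 p.2 : ℚ)) := by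
  rw [MvPolynomial.monomial_sum_prod]
  exact Finset.prod_congr rfl fun p _ => MvPolynomial.C_mul_X_eq_monomial

theorem totalDegree_forestPolynomial_le (C : Matrix (Fin m) (Fin m) ℕ) :
    (forestPolynomial C).totalDegree ≤ m - 1 := by
  classical
  rw [forestPolynomial_eq_sum]
  refine MvPolynomial.totalDegree_finsetSum_le fun S hS => ?_
  refine (MvPolynomial.totalDegree_finsetProd _ _).trans ?_
  refine (Finset.sum_le_card_nsmul _ _ 1 fun p _ => totalDegree_C_mul_X_le _ _).trans ?_
  simpa using (Finset.mem_filter.1 hS).2.card_le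

theorem forestPolynomial_congr (C D : Matrix (Fin m) (Fin m) ℕ)
    (h : ∀ i j, i ≠ j → C i j = D i j) : forestPolynomial C = forestPolynomial D := by
  classical
  rw [forestPolynomial_eq_sum, forestPolynomial_eq_sum]
  refine Finset.sum_congr rfl fun S hS => Finset.prod_congr rfl fun p hp => ?_
  rw [h _ _ ((Finset.mem_filter.1 hS).2.fst_ne_snd hp)]

/-! ### The forest polynomial satisfies the axioms -/

theorem hasCycle_map {n : ℕ} (f : Fin m ↪ Fin n) (S : Finset (Fin m × Fin m)) :
    HasCycle (S.map (f.prodMap f)) ↔ HasCycle S := by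
  constructor
  · rintro ⟨k, p, hp, hS, h⟩
    choose r hr hrp using fun t => Finset.mem_map.1 (hS t)
    refine ⟨k, r, fun s t hst => hp (by rw [← hrp, ← hrp, hst]), hr, fun t => f.injective ?_⟩
    have := h t
    rw [← hrp, ← hrp] at this
    exact this
  · rintro ⟨k, p, hp, hS, h⟩
    exact ⟨k, fun t => f.prodMap f (p t), (f.prodMap f).injective.comp hp,
      fun t => Finset.mem_map_of_mem _ (hS t), fun t => congrArg f (h t)⟩

theorem admissible_map {n : ℕ} (f : Fin m ↪ Fin n) (S : Finset (Fin m × Fin m)) :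
    Admissible (S.map (f.prodMap f)) ↔ Admissible S := by
  rw [Admissible, Admissible, hasCycle_map]
  refine and_congr_left fun _ => ?_
  simp only [Finset.forall_mem_map]
  refine forall₄_congr fun p _ p' _ => ?_
  rw [(f.prodMap f).injective.eq_iff]
  exact imp_congr_left f.injective.eq_iff

/-- Vertices which are not a first entry do not occur in cycles. -/
theorem hasCycle_insert {S : Finset (Fin m × Fin m)} {i j : Fin m} [DecidableEq (Fin m × Fin m)]
    (hj : ∀ p ∈ insert (i, j) S, p.1 ≠ j) : HasCycle (insert (i, j) S) ↔ HasCycle S := by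
  constructor
  · rintro ⟨k, p, hp, hS, h⟩
    refine ⟨k, p, hp, fun t => (Finset.mem_insert.1 (hS t)).resolve_left fun hpt => ?_, h⟩
    exact hj _ (hS (t + 1)) (by rw [← h t, hpt])
  · rintro ⟨k, p, hp, hS, h⟩
    exact ⟨k, p, hp, fun t => Finset.mem_insert_of_mem (hS t), h⟩

theorem Admissible.mono {S T : Finset (Fin m × Fin m)} (hT : Admissible T) (h : S ⊆ T) :
    Admissible S :=
  ⟨fun p hp p' hp' => hT.1 p (h hp) p' (h hp'),
    fun ⟨n, p, hp, hS, hc⟩ => hT.2 ⟨n, p, hp, fun t => h (hS t), hc⟩⟩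

/-- A set of pairs on the first `m` vertices, with a pair `(i, m + 1)` added for `some i`. -/
def extendPairs (S : Finset (Fin m × Fin m)) : Option (Fin m) → Finset (Fin (m + 1) × Fin (m + 1))
  | none => S.map (Fin.castSuccEmb.prodMap Fin.castSuccEmb)
  | some i => insert (i.castSucc, Fin.last m)
      (S.map (Fin.castSuccEmb.prodMap Fin.castSuccEmb))

theorem mem_extendPairs_castSucc {S : Finset (Fin m × Fin m)} {o : Option (Fin m)} {i j : Fin m} :
    (i.castSucc, j.castSucc) ∈ extendPairs S o ↔ (i, j) ∈ S := by
  cases o <;> simp [extendPairs, (Fin.castSucc_lt_last _).ne]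

theorem mem_extendPairs_last {S : Finset (Fin m × Fin m)} {o : Option (Fin m)} {i : Fin m} :
    (i.castSucc, Fin.last m) ∈ extendPairs S o ↔ o = some i := by
  cases o <;> simp [extendPairs, (Fin.castSucc_lt_last _).ne, eq_comm]

theorem fst_ne_last_of_mem_extendPairs {S : Finset (Fin m × Fin m)} {o : Option (Fin m)}
    {p : Fin (m + 1) × Fin (m + 1)} (hp : p ∈ extendPairs S o) : p.1 ≠ Fin.last m := by
  rintro h
  obtain ⟨a, b⟩ := p
  subst h
  cases o <;> simp [extendPairs, (Fin.castSucc_lt_last _).ne, (Fin.castSucc_lt_last _).ne'] at hp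

theorem notMem_map_castSucc (S : Finset (Fin m × Fin m)) (a : Fin (m + 1)) :
    (a, Fin.last m) ∉ S.map
      (Fin.castSuccEmb.prodMap Fin.castSuccEmb) := by
  simp [(Fin.castSucc_lt_last _).ne]

theorem admissible_extendPairs {S : Finset (Fin m × Fin m)} (hS : Admissible S)
    (o : Option (Fin m)) : Admissible (extendPairs S o) := by
  rcases o with _ | i
  · exact (admissible_map _ S).2 hS
  · have h := (admissible_map Fin.castSuccEmb S).2 hS
    refine ⟨fun p hp p' hp' hpp => ?_, ?_⟩
    · simp only [extendPairs] at hp hp'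
      rcases Finset.mem_insert.1 hp with rfl | hp <;> rcases Finset.mem_insert.1 hp' with rfl | hp'
      · rfl
      · exact absurd (by rwa [show p' = (p'.1, Fin.last m) from Prod.ext rfl hpp.symm] at hp')
          (notMem_map_castSucc S p'.1)
      · exact absurd (by rwa [show p = (p.1, Fin.last m) from Prod.ext rfl hpp] at hp)
          (notMem_map_castSucc S p.1)
      · exact h.1 p hp p' hp' hpp
    · rw [extendPairs, hasCycle_insert fun p hp => fst_ne_last_of_mem_extendPairs (o := some i) hp]
      exact h.2

theorem extendPairs_injective :
    Function.Injective fun x : Finset (Fin m × Fin m) × Option (Fin m) =>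
      extendPairs x.1 x.2 := by
  rintro ⟨S, o⟩ ⟨T, o'⟩ h
  refine Prod.ext (Finset.ext fun p => ?_) (Option.ext fun i => ?_)
  · rw [← mem_extendPairs_castSucc (o := o), ← mem_extendPairs_castSucc (o := o')]
    exact iff_of_eq (congrArg (_ ∈ ·) h)
  · change o = some i ↔ o' = some i
    rw [← mem_extendPairs_last (S := S), ← mem_extendPairs_last (S := T)]
    exact iff_of_eq (congrArg (_ ∈ ·) h)

/-- If the last vertex is never a first entry, it is a leaf or isolated: distinctness of second
entries permits at most one pair ending there. -/
theorem exists_extendPairs_eq {T : Finset (Fin (m + 1) × Fin (m + 1))} (hT : Admissible T)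
    (hlast : ∀ p ∈ T, p.1 ≠ Fin.last m) :
    ∃ S : Finset (Fin m × Fin m), Admissible S ∧ ∃ o, extendPairs S o = T := by
  classical
  set S : Finset (Fin m × Fin m) := Finset.univ.filter fun p => (p.1.castSucc, p.2.castSucc) ∈ T
  have hS : Admissible S := by
    refine (admissible_map Fin.castSuccEmb S).1 (hT.mono fun p hp => ?_)
    obtain ⟨r, hr, rfl⟩ := Finset.mem_map.1 hp
    exact (Finset.mem_filter.1 hr).2
  obtain ⟨o, ho⟩ : ∃ o : Option (Fin m), ∀ i, o = some i ↔ (i.castSucc, Fin.last m) ∈ T := by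
    by_cases h : ∃ i : Fin m, (i.castSucc, Fin.last m) ∈ T
    · obtain ⟨i, hi⟩ := h
      refine ⟨some i, fun j => ⟨fun h => ?_, fun hj => ?_⟩⟩
      · rwa [← Option.some.inj h]
      · have := congrArg Prod.fst (hT.1 _ hi _ hj rfl)
        exact congrArg some (Fin.castSucc_injective m this)
    · exact ⟨none, fun j => ⟨fun h => by simp at h, fun hj => absurd ⟨j, hj⟩ h⟩⟩
  refine ⟨S, hS, o, Finset.ext fun ⟨a, b⟩ => ?_⟩
  induction a using Fin.lastCases with
  | last =>
    exact iff_of_false (fun h => fst_ne_last_of_mem_extendPairs h rfl) fun h => hlast _ h rfl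
  | cast i =>
    induction b using Fin.lastCases with
    | last => rw [mem_extendPairs_last, ho]
    | cast j => rw [mem_extendPairs_castSucc]; simp [S]

theorem forestPolynomial_satisfiesAxioms : SatisfiesAxioms (fun _ C => forestPolynomial C) where
  A0 C := by simp [forestPolynomial]
  A1 m _ C _ σ := by
    classical
    rw [forestPolynomial_eq_sum, forestPolynomial_eq_sum, map_sum]
    refine Finset.sum_equiv (Equiv.prodCongr σ σ).finsetCongr (fun S => ?_) fun S _ => ?_
    · simp only [Finset.mem_filter, Finset.mem_univ, true_and]
      exact (admissible_map σ.toEmbedding S).symm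
    · simp [pairsWeight]
  A2 m _ C _ := by
    classical
    have hX : (1 : MvPolynomial (Fin m) ℚ) + ∑ i : Fin m,
        MvPolynomial.C (C i.castSucc (Fin.last m) : ℚ) * MvPolynomial.X i =
        ∑ o : Option (Fin m), o.elim 1
          fun i => MvPolynomial.C (C i.castSucc (Fin.last m) : ℚ) * MvPolynomial.X i := by
      rw [Fintype.sum_option]
      rfl
    rw [forestPolynomial_eq_sum, forestPolynomial_eq_sum, map_sum, hX, Finset.sum_mul_sum,
      ← Finset.sum_product']
    refine (Finset.sum_of_injOn _ extendPairs_injective.injOn ?_ ?_ ?_).symm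
    · rintro ⟨S, o⟩ hS
      simp only [Finset.coe_product, Set.mem_prod, Finset.mem_coe, Finset.mem_filter,
        Finset.mem_univ, true_and] at hS
      simpa using admissible_extendPairs hS.1 o
    -- Sets outside the image contain a pair starting at the last vertex, so their weight vanishes
    -- at `x_(m+1) = 0`.
    · intro T hT hT'
      have hT := (Finset.mem_filter.1 hT).2
      by_cases h : ∀ p ∈ T, p.1 ≠ Fin.last m
      · obtain ⟨S, hS, o, rfl⟩ := exists_extendPairs_eq hT h
        exact absurd ⟨(S, o), by simpa using hS, rfl⟩ hT'
      · push Not at h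
        obtain ⟨p, hp, hpl⟩ := h
        rw [pairsWeight, map_prod]
        exact Finset.prod_eq_zero hp (by simp [hpl])
    · rintro ⟨S, o⟩ -
      cases o with
      | none => simp [extendPairs, pairsWeight]
      | some i =>
        simp only [extendPairs, pairsWeight]
        rw [Finset.prod_insert (notMem_map_castSucc S _)]
        simp [mul_comm]

/-! ### The matrix-tree identity and the explicit formula -/

theorem forestPolynomial_eq_det (C : Matrix (Fin m) (Fin m) ℕ) (hC : C.IsSymm) :
    forestPolynomial C = (forestMatrix C).det := by
  rcases Nat.eq_zero_or_pos m with rfl | hm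
  · simp [forestPolynomial]
  · exact forestPolynomial_satisfiesAxioms.unique det_forestMatrix_satisfiesAxioms
      (fun _ C _ _ => totalDegree_forestPolynomial_le C)
      (fun _ C hm _ => totalDegree_det_forestMatrix_le C hm) m C hm hC

theorem limitCoeff_one (C : Matrix (Fin m) (Fin m) ℕ) (hC : C.IsSymm) (l : Fin m → ℕ) :
    (limitCoeff C 1 l : ℚ) = (-1) ^ (∑ i, (C i i + 1) * l i)
      * MvPolynomial.eval (fun i => (l i : ℚ)) (forestPolynomial C)
      * ∏ j, (1 / (1 + ∑ i, (C i j : ℚ) * (l i : ℚ)))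
          * ((1 + ∑ i, C i j * l i).choose (l j) : ℚ) := by
  rw [limitCoeff, Int.cast_mul, det_limitMatrix_one, forestPolynomial_eq_det C hC,
    RingHom.map_det, ← Matrix.det_transpose (RingHom.mapMatrix _ _)]
  -- Transposition is needed because `forestMatrix` carries its variables along rows and the limit
  -- matrix carries `l` along columns; symmetry of `C` reconciles them.
  have : ((MvPolynomial.eval fun i => (l i : ℚ)).mapMatrix (forestMatrix C)).transpose =
      Matrix.of fun i j => (if i = j then 1 + ∑ k, (C k j : ℚ) * (l k : ℚ) else 0)
          - (C i j : ℚ) * (l j : ℚ) := by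
    ext i j
    rcases eq_or_ne i j with rfl | hij
    · simp [forestMatrix]
    · simp [forestMatrix, hij, hij.symm, hC.apply i j]
  rw [this]
  push_cast
  ring

/-! ### Exact degree for connected quivers -/

/-- Fix a root `r` and join each other vertex to a neighbour closer to `r`: this is a spanning tree.
-/
theorem exists_admissible_of_connected (C : Matrix (Fin m) (Fin m) ℕ) (hC : C.IsSymm)
    (h : (underlyingGraph C).Connected) :
    ∃ S : Finset (Fin m × Fin m), Admissible S ∧ S.card = m - 1 ∧ ∀ p ∈ S, C p.1 p.2 ≠ 0 := by
  classical
  obtain ⟨r⟩ := h.nonempty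
  have hparent (j : Fin m) : ∃ i, j ≠ r → C i j ≠ 0 ∧
      (underlyingGraph C).dist i r < (underlyingGraph C).dist j r := by
    obtain ⟨w, hw⟩ := h.exists_walk_length_eq_dist j r
    cases w with
    | nil => exact ⟨r, fun hj => absurd rfl hj⟩
    | @cons _ i _ hadj w =>
      refine ⟨i, fun _ => ⟨?_, ?_⟩⟩
      · have := (SimpleGraph.fromRel_adj _ _ _).1 hadj
        rw [hC.apply i j, or_self] at this
        exact this.2
      · have := SimpleGraph.dist_le w
        rw [SimpleGraph.Walk.length_cons] at hw
        omega
  choose f hf using hparent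
  refine ⟨(Finset.univ.erase r).image fun j => (f j, j), ⟨?_, ?_⟩, ?_, ?_⟩
  · simp +contextual
  · rintro ⟨n, p, -, hS, hc⟩
    -- Distance to `r` would increase strictly all the way round a cycle.
    have hlt (t : Fin (n + 1)) : (underlyingGraph C).dist (p t).1 r <
        (underlyingGraph C).dist (p (t + 1)).1 r := by
      rw [← hc]
      obtain ⟨j, hj, hjp⟩ := Finset.mem_image.1 (hS t)
      rw [← hjp]
      exact (hf j (Finset.ne_of_mem_erase hj)).2
    obtain ⟨t, ht⟩ := Finite.exists_max fun t => (underlyingGraph C).dist (p t).1 r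
    exact (hlt t).not_ge (ht (t + 1))
  · rw [Finset.card_image_of_injective _ fun i j hij => congrArg Prod.snd hij]
    simp
  · intro p hp
    obtain ⟨j, hj, rfl⟩ := Finset.mem_image.1 hp
    exact (hf j (Finset.ne_of_mem_erase hj)).1

theorem totalDegree_forestPolynomial_of_connected (C : Matrix (Fin m) (Fin m) ℕ) (hC : C.IsSymm)
    (h : (underlyingGraph C).Connected) : (forestPolynomial C).totalDegree = m - 1 := by
  classical
  refine (totalDegree_forestPolynomial_le C).antisymm ?_
  obtain ⟨S, hS, hcard, hne⟩ := exists_admissible_of_connected C hC h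
  -- All weights have nonnegative coefficients, so the tree's monomial cannot cancel.
  have hpos : 0 < MvPolynomial.coeff (∑ p ∈ S, Finsupp.single p.1 1) (forestPolynomial C) := by
    rw [forestPolynomial_eq_sum, MvPolynomial.coeff_sum]
    refine Finset.sum_pos' (fun T _ => ?_) ⟨S, by simpa using hS, ?_⟩
    · rw [pairsWeight_eq_monomial, MvPolynomial.coeff_monomial]
      split_ifs <;> positivity
    · rw [pairsWeight_eq_monomial, MvPolynomial.coeff_monomial, if_pos rfl]
      exact Finset.prod_pos fun p hp => by exact_mod_cast Nat.pos_of_ne_zero (hne p hp)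
  have := MvPolynomial.le_totalDegree (MvPolynomial.mem_support_iff.2 hpos.ne')
  refine le_of_eq_of_le ?_ this
  rw [← hcard]
  change _ = Finsupp.degree _
  simp [map_sum, Finsupp.degree_single]

end SymmetricQuiver

open SymmetricQuiver in
theorem mainTheorem1 :
    -- the classical limit exists coefficientwise and is given by the explicit formula
    (∀ (m : ℕ) (C : Matrix (Fin m) (Fin m) ℕ), C.IsSymm → ∀ l : Fin m →₀ ℕ,
      Tendsto (fun q : ℝ => MvPowerSeries.coeff l (seriesRatio C q)) (𝓝[≠] 1)
        (𝓝 (((-1) ^ (∑ i, (C i i + 1) * l i)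
            * MvPolynomial.eval (fun i => (l i : ℚ)) (forestPolynomial C)
            * ∏ j, (1 / (1 + ∑ i, (C i j : ℚ) * (l i : ℚ)))
                * ((1 + ∑ i, C i j * l i).choose (l j) : ℚ) : ℚ) : ℝ))) ∧
    -- `A` has degree at most `m - 1`, with equality when the quiver is connected
    (∀ (m : ℕ) (C : Matrix (Fin m) (Fin m) ℕ), C.IsSymm →
      (forestPolynomial C).totalDegree ≤ m - 1 ∧
      ((underlyingGraph C).Connected → (forestPolynomial C).totalDegree = m - 1)) ∧
    -- the coefficients of `A` depend only on the off-diagonal entries of the matrix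
    (∀ (m : ℕ) (C D : Matrix (Fin m) (Fin m) ℕ), C.IsSymm → D.IsSymm →
      (∀ i j, i ≠ j → C i j = D i j) → forestPolynomial C = forestPolynomial D) ∧
    -- `A` satisfies (A0), (A1), (A2)
    SatisfiesAxioms (fun _ C => forestPolynomial C) ∧
    -- and is the only such family of polynomials of degree at most `m - 1`
    (∀ P : ∀ m : ℕ, Matrix (Fin m) (Fin m) ℕ → MvPolynomial (Fin m) ℚ,
      SatisfiesAxioms P →
      (∀ (m : ℕ) (C : Matrix (Fin m) (Fin m) ℕ), 1 ≤ m → C.IsSymm →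
        (P m C).totalDegree ≤ m - 1) →
      ∀ (m : ℕ) (C : Matrix (Fin m) (Fin m) ℕ), 1 ≤ m → C.IsSymm →
        P m C = forestPolynomial C) := by
  refine ⟨fun m C hC l => ?_, fun m C hC => ⟨totalDegree_forestPolynomial_le C,
    totalDegree_forestPolynomial_of_connected C hC⟩, fun m C D _ _ => forestPolynomial_congr C D,
    forestPolynomial_satisfiesAxioms, fun P hP hdeg m C hm hC => ?_⟩
  · rw [← limitCoeff_one C hC l, Rat.cast_intCast]
    simpa only [shiftedRatio_one] using tendsto_coeff_shiftedRatio C hC 1 l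
  · exact hP.unique forestPolynomial_satisfiesAxioms hdeg
      (fun _ C _ _ => totalDegree_forestPolynomial_le C) m C hm hC
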